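/- \textbf{One-bit feedback sum-rate.} Let $N_n,N_f\ge 1$ be integers, $\Omega_p,\Omega_n,\Omega_f>0$, $I>0$, $P_{\mathrm{peak}}>0$, and let $0<a_n<a_f$ with $a_n+a_f=1$. Let $h_p\sim\mathcal{CN}(0,\Omega_p)$, $h_{n,i}\sim\mathcal{CN}(0,\Omega_n)$ $(1\le i\le N_n)$ and $h_{f,j}\sim\mathcal{CN}(0,\Omega_f)$ $(1\le j\le N_f)$ be mutually independent circularly symmetric complex Gaussian channel coefficients, and put $g_p=|h_p|^2$, $g_n=\sum_i|h_{n,i}|^2$, $g_f=\sum_j|h_{f,j}|^2$, $g_{\min}=\min\{g_n,g_f\}$, $\tau=I/P_{\mathrm{peak}}$ and $\Omega=\Omega_n\Omega_f/(\Omega_n+\Omega_f)$. With one-bit feedback the transmit power is $P_t^*=P_{\mathrm{peak}}$ if $g_p\le\tau$ and $P_t^*=0$ otherwise. The average NOMA sum-rate is $$C_{\mathrm{sum}}=\mathbb E\Big[\log_2(1+a_ng_nP_t^*)+\min_{u\in\{n,f\}}\log_2\Big(1+\frac{a_fg_uP_t^*}{a_ng_uP_t^*+1}\Big)\Big].$$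 Then the random variable in this expectation is integrable, so is the one in the following expectation, $$C_{\mathrm{sum}}=\mathbb E\big[\log_2(1+a_nP_t^*g_n)+\log_2(1+P_t^*g_{\min})-\log_2(1+a_nP_t^*g_{\min})\big],$$ and, writing $$\mathcal G_N(z)=G^{3,1}_{2,3}\left(z\,\middle|\,\begin{matrix}-N,\ 1-N\\ 0,\ -N,\ -N\end{matrix}\right)$$ for Meijer's $G$-function with these parameters, i.e. $$\mathcal G_N(z)=\frac1{2\pi i}\int_{\sigma-i\infty}^{\sigma+i\infty}\frac{\Gamma(-s)\,\Gamma(-N-s)^2\,\Gamma(1+N+s)}{\Gamma(1-N-s)}\,z^s\,ds,\qquad -N-1<\sigma<-N,$$ one has $$\begin{aligned}C_{\mathrm{sum}}=\frac{1-e^{-\tau/\Omega_p}}{\ln 2}\Bigg[&\frac{1}{\Gamma(N_n)\,\Omega_n^{N_n}(a_nP_{\mathrm{peak}})^{N_n}}\,\mathcal G_{N_n}\!\Big(\frac1{\Omega_na_nP_{\mathrm{peak}}}\Big)\\ &+\frac1{\Gamma(N_n)\,\Omega_n^{N_n}}\sum_{k=0}^{N_f-1}\frac1{k!\,\Omega_f^k\,P_{\mathrm{peak}}^{N_n+k}}\Big\{\mathcal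 G_{N_n+k}\!\Big(\frac1{\Omega P_{\mathrm{peak}}}\Big)-\frac1{a_n^{N_n+k}}\,\mathcal G_{N_n+k}\!\Big(\frac1{\Omega a_nP_{\mathrm{peak}}}\Big)\Big\}\\ &+\frac1{\Gamma(N_f)\,\Omega_f^{N_f}}\sum_{l=0}^{N_n-1}\frac1{l!\,\Omega_n^l\,P_{\mathrm{peak}}^{N_f+l}}\Big\{\mathcal G_{N_f+l}\!\Big(\frac1{\Omega P_{\mathrm{peak}}}\Big)-\frac1{a_n^{N_f+l}}\,\mathcal G_{N_f+l}\!\Big(\frac1{\Omega a_nP_{\mathrm{peak}}}\Big)\Big\}\Bigg].\end{aligned}$$ -/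

import Mathlib

open MeasureTheory ProbabilityTheory

noncomputable section

namespace NOMA

/-! ## Meijer's G-function -/

/-- The Mellin-Barnes integrand of `G^{m,n}_{p,q}(z | a ; b)` at the point `s`:
`∏_{j ≤ m} Γ(b_j - s) ∏_{j ≤ n} Γ(1 - a_j + s) z ^ s` divided by
`∏_{m < j ≤ q} Γ(1 - b_j + s) ∏_{n < j ≤ p} Γ(a_j - s)` (indices shifted to start at `0`). -/
def meijerIntegrand (m n : ℕ) {p q : ℕ} (a : Fin p → ℂ) (b : Fin q → ℂ) (z s : ℂ) : ℂ :=
  (∏ j : Fin q, if (j : ℕ) < m then Complex.Gamma (b j - s)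
      else (Complex.Gamma (1 - b j + s))⁻¹) *
  (∏ j : Fin p, if (j : ℕ) < n then Complex.Gamma (1 - a j + s)
      else (Complex.Gamma (a j - s))⁻¹) * z ^ s

/-- The vertical line `Re s = σ` separates the two families of poles: those of
`Γ(1 - a_j + s)`, `j ≤ n`, at `a_j - 1 - ℓ`, lie strictly to its left and those of
`Γ(b_j - s)`, `j ≤ m`, at `b_j + ℓ`, lie strictly to its right (`ℓ = 0, 1, 2, …`). -/
def MeijerSeparates (m n : ℕ) {p q : ℕ} (a : Fin p → ℂ) (b : Fin q → ℂ) (σ : ℝ) : Prop :=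
  (∀ j : Fin p, (j : ℕ) < n → (a j).re - 1 < σ) ∧
  (∀ j : Fin q, (j : ℕ) < m → σ < (b j).re)

open Classical in
/-- Meijer's function `G^{m,n}_{p,q}(z | a ; b) = (1 / 2πi) ∫_L integrand(s) ds`, where `L` is a
vertical line `s = σ + i t` (so `ds = i dt`), traversed upwards, which separates the two families
of poles. Where the integral converges absolutely for all separating lines (in particular for
`|arg z| < (m + n - (p + q) / 2) π`), its value does not depend on the line, by Cauchy's theorem.
Parameters for which only an indented line separates the poles are not covered (value `0`). -/
def meijerG (m n : ℕ) {p q : ℕ} (a : Fin p → ℂ) (b : Fin q → ℂ) (z : ℂ) : ℂ :=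
  if h : ∃ σ : ℝ, MeijerSeparates m n a b σ then
    (1 / (2 * (Real.pi : ℂ))) *
      ∫ t : ℝ, meijerIntegrand m n a b z ((h.choose : ℂ) + (t : ℂ) * Complex.I)
  else 0

/-- The function `G^{3,1}_{2,3}(z | -N, 1 - N ; 0, -N, -N)`, at a real argument `z`. -/
def gTerm (N : ℕ) (z : ℝ) : ℂ :=
  meijerG 3 1 ![-(N : ℂ), 1 - (N : ℂ)] ![0, -(N : ℂ), -(N : ℂ)] (z : ℂ)

/-- In `gTerm` the separating vertical lines are exactly those with `-N - 1 < σ < -N`. -/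
theorem meijerSeparates_gTerm_iff (N : ℕ) (σ : ℝ) :
    MeijerSeparates 3 1 ![-(N : ℂ), 1 - (N : ℂ)] ![0, -(N : ℂ), -(N : ℂ)] σ ↔
      -(N : ℝ) - 1 < σ ∧ σ < -(N : ℝ) := by
  have h0 : (0 : ℝ) ≤ N := Nat.cast_nonneg N
  simp only [MeijerSeparates, Fin.forall_fin_succ, Fin.forall_fin_zero]
  simp
  intro _ h
  linarith

/-! ## The channel -/

/-- The circularly symmetric complex normal law `CN(0, v)`: real and imaginary part are independent
real Gaussians with mean `0` and variance `v / 2`. -/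
def complexNormal (v : ℝ) : Measure ℂ :=
  ((gaussianReal 0 (v / 2).toNNReal).prod (gaussianReal 0 (v / 2).toNNReal)).map
    Complex.measurableEquivRealProd.symm

/-- Channel gain `hᴴ h = ∑ i, |h i| ^ 2` after maximal-ratio combining over the receive antennas. -/
def mrcGain {N : ℕ} (h : Fin N → ℂ) : ℝ := ∑ i, ‖h i‖ ^ 2

/-- Transmit power under one-bit feedback: `Ppeak` if `gp ≤ τ = I / Ppeak`, silence otherwise. -/
def oneBitPower (I Ppeak gp : ℝ) : ℝ := if gp ≤ I / Ppeak then Ppeak else 0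

/-- SINR for decoding the far user's symbol at a receiver with channel gain `g`, when the transmit
power is `P`. -/
def sinrFar (an af P g : ℝ) : ℝ := af * g * P / (an * g * P + 1)

/-- SNR for decoding the near user's symbol at the near user, after interference cancellation. -/
def snrNear (an P g : ℝ) : ℝ := an * g * P

/-- Instantaneous NOMA sum-rate: rate `log₂ (1 + SNR)` of the near user, plus rate of the far user,
whose symbol has to be decoded at both receivers. -/
def sumRate (an af P gn gf : ℝ) : ℝ :=
  Real.logb 2 (1 + snrNear an P gn) +
    min (Real.logb 2 (1 + sinrFar an af P gn)) (Real.logb 2 (1 + sinrFar an af P gf))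

/-- Instantaneous NOMA sum-rate with one-bit feedback, as a function of the channel coefficients. -/
def oneBitSumRate (an af I Ppeak : ℝ) {Nn Nf : ℕ} (hp : ℂ) (hn : Fin Nn → ℂ) (hf : Fin Nf → ℂ) :
    ℝ :=
  sumRate an af (oneBitPower I Ppeak (‖hp‖ ^ 2)) (mrcGain hn) (mrcGain hf)

/-- The same rate in the form
`log₂ (1 + an P gn) + log₂ (1 + P gmin) - log₂ (1 + an P gmin)`, with `gmin = min gn gf`. -/
def oneBitSumRateMin (an I Ppeak : ℝ) {Nn Nf : ℕ} (hp : ℂ) (hn : Fin Nn → ℂ)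
    (hf : Fin Nf → ℂ) : ℝ :=
  let P := oneBitPower I Ppeak (‖hp‖ ^ 2)
  let gmin := min (mrcGain hn) (mrcGain hf)
  Real.logb 2 (1 + an * P * mrcGain hn) + Real.logb 2 (1 + P * gmin)
    - Real.logb 2 (1 + an * P * gmin)

end NOMA

end

noncomputable section

namespace NOMA

open Set Filter Topology

/-! Rate side. Since `an + af = 1`, one has `1 + SINR = (1 + P g) / (1 + an P g)`, which increases
with `g`; the minimum over the two receivers is therefore attained at the smaller gain, and this is
the second form of the rate. A silent transmitter contributes rate `0`, so the rate is the indicator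
of `gp ≤ τ` times a function of the two gains alone. By independence its mean is `1 - exp (-τ / Ωp)`
times the mean at peak power.

Probability side. Characteristic functions show that the gains have Erlang laws. To average a
function of their minimum, split according to which gain is smaller: each piece is an integral of
that function against one Erlang density times the tail of the other. The tail is a finite sum of
monomials times an exponential, so every mean of a logarithm becomes a finite sum of integrals `∫
log (1 + y) y^(N-1) e^(-zy) dy`, called `logLaplace`. In the terms coming from the minimum the rates
add up to `1/Ωn + 1/Ωf = 1/Ω`.

Analytic side. The core is `gTerm_eq_logLaplace`: the Meijer function equals `logLaplace`. The
Mellin transform of a Laplace transform is `Γ(w)` times the Mellin transform of the original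
function at `1 - w`. For `y^(N-1) log (1 + y)` this gives `Γ(w) Γ(1 + N - w) Γ(w - N) / (w - N)` on
`N < Re w < N + 1`, which is the Meijer integrand at `s = -w`. Decay of Gamma on vertical lines then
permits Mellin inversion. -/

/-! ### Mellin transforms of Laplace transforms -/

/-- The Laplace transform `z ↦ ∫_0^∞ g(y) e^{-zy} dy`. -/
def laplaceIntegral (g : ℝ → ℂ) (z : ℝ) : ℂ :=
  ∫ y in Ioi (0 : ℝ), g y * (Real.exp (-(z * y)) : ℂ)

theorem norm_ofReal_cpow_of_pos {x : ℝ} (hx : 0 < x) (w : ℂ) : ‖(x : ℂ) ^ w‖ = x ^ w.re :=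
  Complex.norm_cpow_eq_rpow_re_of_pos hx w

theorem aestronglyMeasurable_ofReal_cpow (w : ℂ) :
    AEStronglyMeasurable (fun x : ℝ => (x : ℂ) ^ w) (volume.restrict (Ioi 0)) := by
  refine ContinuousOn.aestronglyMeasurable (fun x hx => ?_) measurableSet_Ioi
  exact (Complex.continuousAt_ofReal_cpow_const x w (Or.inr (ne_of_gt hx))).continuousWithinAt

theorem MellinConvergent.aestronglyMeasurable {g : ℝ → ℂ} {w : ℂ} (hg : MellinConvergent g w) :
    AEStronglyMeasurable g (volume.restrict (Ioi 0)) := by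
  have h := (aestronglyMeasurable_ofReal_cpow (1 - w)).mul hg.aestronglyMeasurable
  refine h.congr ?_
  filter_upwards [ae_restrict_mem measurableSet_Ioi] with x hx
  have hx0 : (x : ℂ) ≠ 0 := Complex.ofReal_ne_zero.mpr (ne_of_gt hx)
  simp only [Pi.mul_apply, smul_eq_mul]
  rw [← mul_assoc, ← Complex.cpow_add _ _ hx0]
  simp

/-- Integrability of the double integral behind the Mellin transform of a Laplace transform. -/
theorem integrable_mellin_laplace {g : ℝ → ℂ} {w : ℂ} (hw : 0 < w.re)
    (hg : MellinConvergent g (1 - w)) :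
    Integrable (fun p : ℝ × ℝ => (p.1 : ℂ) ^ (w - 1) * (g p.2 * (Real.exp (-(p.1 * p.2)) : ℂ)))
      ((volume.restrict (Ioi 0)).prod (volume.restrict (Ioi 0))) := by
  have hmeas : AEStronglyMeasurable
      (fun p : ℝ × ℝ => (p.1 : ℂ) ^ (w - 1) * (g p.2 * (Real.exp (-(p.1 * p.2)) : ℂ)))
      ((volume.restrict (Ioi 0)).prod (volume.restrict (Ioi 0))) := by
    refine (aestronglyMeasurable_ofReal_cpow (w - 1)).comp_fst.mul
      ((MellinConvergent.aestronglyMeasurable hg).comp_snd.mul ?_)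
    exact Continuous.aestronglyMeasurable (by fun_prop)
  -- Tonelli with `x` innermost: the norm integrates in `x` to `Γ(Re w) y^(-Re w) ‖g y‖`, whose
  -- integrability is the Mellin convergence of `g` at `1 - w`.
  rw [integrable_prod_iff' hmeas]
  have key : ∀ y : ℝ, 0 < y → ∀ x : ℝ, 0 < x →
      ‖(x : ℂ) ^ (w - 1) * (g y * (Real.exp (-(x * y)) : ℂ))‖ =
        ‖g y‖ * (x ^ (w.re - 1) * Real.exp (-(y * x))) := by
    intro y hy x hx
    rw [norm_mul, norm_mul, norm_ofReal_cpow_of_pos hx, Complex.norm_real, Real.norm_eq_abs,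
      abs_of_pos (Real.exp_pos _), mul_comm x y]
    simp; ring
  have hint : ∀ y : ℝ, 0 < y →
      IntegrableOn (fun x : ℝ => x ^ (w.re - 1) * Real.exp (-(y * x))) (Ioi 0) := by
    intro y hy
    have := integrableOn_rpow_mul_exp_neg_mul_rpow (p := 1) (s := w.re - 1) (b := y)
      (by linarith) one_pos hy
    simpa using this
  constructor
  · filter_upwards [ae_restrict_mem measurableSet_Ioi] with y hy
    have hm : AEStronglyMeasurable
        (fun x : ℝ => (x : ℂ) ^ (w - 1) * (g y * (Real.exp (-(x * y)) : ℂ)))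
        (volume.restrict (Ioi 0)) :=
      (aestronglyMeasurable_ofReal_cpow (w - 1)).mul (Continuous.aestronglyMeasurable (by fun_prop))
    rw [← integrable_norm_iff hm]
    refine ((hint y hy).const_mul ‖g y‖).congr ?_
    filter_upwards [ae_restrict_mem measurableSet_Ioi] with x hx
    exact (key y hy x hx).symm
  · refine (hg.norm.mul_const (Real.Gamma w.re)).congr ?_
    filter_upwards [ae_restrict_mem measurableSet_Ioi] with y hy
    have hy' : 0 < y := hy
    rw [setIntegral_congr_fun measurableSet_Ioi (fun x hx => key y hy x hx),
      integral_const_mul, Real.integral_rpow_mul_exp_neg_mul_Ioi hw hy, norm_smul,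
      norm_ofReal_cpow_of_pos hy]
    simp only [Complex.sub_re, Complex.one_re]
    rw [one_div, Real.inv_rpow hy'.le, ← Real.rpow_neg hy'.le,
      show 1 - w.re - 1 = -w.re by ring]
    ring

/-- Fubini: integrating `x^(w-1) e^(-xy)` over `x` first leaves `Γ(w) y^(-w)`, and `-w = (1 - w) -
1` is a Mellin exponent again. -/
theorem hasMellin_laplaceIntegral {g : ℝ → ℂ} {w : ℂ} (hw : 0 < w.re)
    (hg : MellinConvergent g (1 - w)) :
    HasMellin (laplaceIntegral g) w (Complex.Gamma w * mellin g (1 - w)) := by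
  have hI := integrable_mellin_laplace hw hg
  have hin : ∀ x : ℝ, ∫ y in Ioi (0 : ℝ), (x : ℂ) ^ (w - 1) * (g y * (Real.exp (-(x * y)) : ℂ)) =
      (x : ℂ) ^ (w - 1) • laplaceIntegral g x := fun x => by
    rw [integral_const_mul, laplaceIntegral, smul_eq_mul]
  constructor
  · have := hI.integral_prod_left
    simp only [hin] at this
    exact this
  · have hswap := integral_integral_swap
      (f := fun (x y : ℝ) => (x : ℂ) ^ (w - 1) * (g y * (Real.exp (-(x * y)) : ℂ))) hI
    simp only [hin] at hswap
    rw [mellin, hswap, mellin, ← integral_const_mul]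
    refine setIntegral_congr_fun measurableSet_Ioi fun y (hy : 0 < y) => ?_
    have h1 : ∀ x : ℝ, (x : ℂ) ^ (w - 1) * (g y * (Real.exp (-(x * y)) : ℂ)) =
        g y * ((x : ℂ) ^ (w - 1) * Complex.exp (-(y * x))) := fun x => by
      push_cast; rw [mul_comm (x : ℂ) y]; ring
    simp only [h1]
    rw [integral_const_mul, Complex.integral_cpow_mul_exp_neg_mul_Ioi hw hy, one_div,
      Complex.inv_cpow _ _ (by rw [Complex.arg_ofReal_of_nonneg hy.le]; exact Real.pi_pos.ne),
      ← Complex.cpow_neg, smul_eq_mul, show (1 - w - 1) = -w by ring]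
    ring

/-! ### Mellin transforms of `1 / (1 + y)` and `log (1 + y)` -/

/-- The Mellin transform of `1 / (1 + y)`. -/
theorem hasMellin_inv_one_add {b : ℂ} (h0 : 0 < b.re) (h1 : b.re < 1) :
    HasMellin (fun y : ℝ => ((1 + y : ℝ) : ℂ)⁻¹) b
      (Complex.Gamma b * Complex.Gamma (1 - b)) := by
  have h1' : 0 < (1 - b).re := by simp; linarith
  have hconv : MellinConvergent (fun t : ℝ => (Real.exp (-t) : ℂ)) (1 - b) := by
    refine (Complex.GammaIntegral_convergent h1').congr ?_
    exact ae_of_all _ fun x => by simp [mul_comm]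
  have hM : mellin (fun t : ℝ => (Real.exp (-t) : ℂ)) (1 - b) = Complex.Gamma (1 - b) := by
    rw [Complex.Gamma_eq_integral h1', Complex.GammaIntegral_eq_mellin]
  have h := hasMellin_laplaceIntegral h0 hconv
  rw [hM] at h
  -- `1 / (1 + z)` is the Laplace transform of `e^(-t)`, whose Mellin transform is Gamma.
  have hE : EqOn (laplaceIntegral fun t : ℝ => (Real.exp (-t) : ℂ))
      (fun y : ℝ => ((1 + y : ℝ) : ℂ)⁻¹) (Ioi 0) := by
    intro z (hz : 0 < z)
    have h2 : ∀ y : ℝ, (Real.exp (-y) : ℂ) * (Real.exp (-(z * y)) : ℂ) =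
        ((Real.exp (-(1 + z) * y) : ℝ) : ℂ) := fun y => by
      rw [← Complex.ofReal_mul, ← Real.exp_add]; congr 2; ring
    simp only [laplaceIntegral, h2]
    rw [integral_complex_ofReal, integral_exp_mul_Ioi (by linarith)]
    simp only [mul_zero, Real.exp_zero]
    rw [← Complex.ofReal_inv]
    congr 1
    rw [neg_div_neg_eq, one_div]
  have hE' : ∀ x ∈ Ioi (0 : ℝ), (x : ℂ) ^ (b - 1) • laplaceIntegral (fun t : ℝ => (Real.exp (-t) : ℂ)) x
      = (x : ℂ) ^ (b - 1) • ((1 + x : ℝ) : ℂ)⁻¹ := fun x hx => by rw [hE hx]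
  constructor
  · exact (integrableOn_congr_fun hE' measurableSet_Ioi).mp h.1
  · rw [← h.2, mellin, mellin]
    exact (setIntegral_congr_fun measurableSet_Ioi hE').symm

/-- Apply `log u ≤ u - 1` to `u = (1 + y)^ε` and use subadditivity of `y ↦ y^ε`. The choice `ε = 1`
serves near `0`, a small `ε` near infinity. -/
theorem log_one_add_le_rpow_div {y ε : ℝ} (hy : 0 < y) (h0 : 0 < ε) (h1 : ε ≤ 1) :
    Real.log (1 + y) ≤ y ^ ε / ε := by
  rw [le_div_iff₀ h0, mul_comm, ← Real.log_rpow (by linarith)]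
  have h : (1 + y) ^ ε ≤ 1 + y ^ ε := by
    simpa using Real.rpow_add_le_add_rpow zero_le_one hy.le h0.le h1
  calc Real.log ((1 + y) ^ ε) ≤ (1 + y) ^ ε - 1 :=
        Real.log_le_sub_one_of_pos (Real.rpow_pos_of_pos (by linarith) _)
    _ ≤ y ^ ε := by linarith

theorem norm_log_one_add_le {y ε : ℝ} (hy : 0 < y) (h0 : 0 < ε) (h1 : ε ≤ 1) :
    ‖(Real.log (1 + y) : ℂ)‖ ≤ y ^ ε / ε := by
  rw [Complex.norm_real, Real.norm_eq_abs, abs_of_nonneg (Real.log_nonneg (by linarith))]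
  exact log_one_add_le_rpow_div hy h0 h1

theorem continuousOn_log_one_add : ContinuousOn (fun y : ℝ => (Real.log (1 + y) : ℂ)) (Ioi 0) := by
  intro y (hy : 0 < y)
  have : (1 + y) ≠ 0 := by linarith
  exact ((Complex.continuous_ofReal.continuousAt).comp
    (((continuous_const.add continuous_id).continuousAt).log this)).continuousWithinAt

theorem mellinConvergent_log_one_add {a : ℂ} (h0 : -1 < a.re) (h1 : a.re < 0) :
    MellinConvergent (fun y : ℝ => (Real.log (1 + y) : ℂ)) a := by
  have hε : 0 < -(a.re / 2) := by linarith
  refine mellinConvergent_of_isBigO_rpow (a := a.re / 2) (b := -1)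
    (continuousOn_log_one_add.locallyIntegrableOn measurableSet_Ioi) ?_ (by linarith) ?_ h0
  · refine Asymptotics.IsBigO.of_bound (-(a.re / 2))⁻¹ ?_
    filter_upwards [eventually_gt_atTop 0] with y hy
    rw [Real.norm_of_nonneg (Real.rpow_nonneg hy.le _), inv_mul_eq_div]
    exact norm_log_one_add_le hy hε (by linarith)
  · refine Asymptotics.IsBigO.of_bound 1 ?_
    filter_upwards [self_mem_nhdsWithin] with y (hy : 0 < y)
    rw [Real.norm_of_nonneg (Real.rpow_nonneg hy.le _), one_mul, neg_neg]
    simpa using norm_log_one_add_le hy one_pos le_rfl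

theorem norm_log_one_add_mul_cpow_div_le {a : ℂ} {y ε : ℝ} (hy : 0 < y) (h0 : 0 < ε)
    (h1 : ε ≤ 1) :
    ‖(Real.log (1 + y) : ℂ) * ((y : ℂ) ^ a / a)‖ ≤ y ^ (ε + a.re) * (ε⁻¹ * ‖a‖⁻¹) := by
  rw [norm_mul, norm_div, norm_ofReal_cpow_of_pos hy, Real.rpow_add hy]
  calc _ ≤ (y ^ ε / ε) * (y ^ a.re / ‖a‖) := by
        gcongr
        exact norm_log_one_add_le hy h0 h1
    _ = _ := by ring

/-- The Mellin transform of `log (1 + y)`. -/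
theorem hasMellin_log_one_add {a : ℂ} (h0 : -1 < a.re) (h1 : a.re < 0) :
    HasMellin (fun y : ℝ => (Real.log (1 + y) : ℂ)) a
      (Complex.Gamma (1 + a) * Complex.Gamma (-a) / (-a)) := by
  have ha : a ≠ 0 := fun h => by simp [h] at h1
  have hconv := mellinConvergent_log_one_add h0 h1
  refine ⟨hconv, ?_⟩
  have hB := hasMellin_inv_one_add (b := 1 + a) (by simp; linarith) (by simp; linarith)
  -- Integration by parts reduces to `1 / (1 + y)` at exponent `1 + a`; both boundary terms vanish
  -- because `-1 < Re a < 0`.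
  have hparts := integral_Ioi_mul_deriv_eq_deriv_mul (a := (0 : ℝ)) (a' := (0 : ℂ)) (b' := (0 : ℂ))
    (u := fun y : ℝ => (Real.log (1 + y) : ℂ)) (u' := fun y : ℝ => ((1 + y : ℝ) : ℂ)⁻¹)
    (v := fun y : ℝ => (y : ℂ) ^ a / a) (v' := fun y : ℝ => (y : ℂ) ^ (a - 1)) ?_ ?_ ?_ ?_ ?_ ?_
  · rw [mellin, show (fun t : ℝ => (t : ℂ) ^ (a - 1) • (Real.log (1 + t) : ℂ)) =
        fun t : ℝ => (Real.log (1 + t) : ℂ) * (t : ℂ) ^ (a - 1) from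
        funext fun t => by rw [smul_eq_mul, mul_comm], hparts,
      show (fun y : ℝ => ((1 + y : ℝ) : ℂ)⁻¹ * ((y : ℂ) ^ a / a)) =
        fun y : ℝ => a⁻¹ * ((y : ℂ) ^ (1 + a - 1) • ((1 + y : ℝ) : ℂ)⁻¹) from
        funext fun y => by rw [smul_eq_mul, add_sub_cancel_left]; ring,
      integral_const_mul]
    have := hB.2
    rw [mellin] at this
    rw [this, show 1 - (1 + a) = -a by ring]
    field_simp
    ring
  · intro y (hy : 0 < y)
    have := ((hasDerivAt_id y).const_add 1).log (by simp; linarith)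
    simpa using this.ofReal_comp
  · intro y (hy : 0 < y)
    have := hasDerivAt_ofReal_cpow_const' (r := a - 1) hy.ne' (by
      intro h; apply ha; linear_combination h)
    simpa using this
  · exact hconv.congr (ae_of_all _ fun y => by simp [mul_comm])
  · refine (hB.1.const_mul a⁻¹).congr (ae_of_all _ fun y => ?_)
    simp only [Pi.mul_apply, smul_eq_mul, add_sub_cancel_left]
    ring
  · have hlim : Tendsto (fun y : ℝ => y ^ (1 + a.re) * ((1 : ℝ)⁻¹ * ‖a‖⁻¹)) (𝓝[>] 0) (𝓝 0) := by
      have h := (Real.continuousAt_rpow_const 0 (1 + a.re) (Or.inr (by linarith))).tendsto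
      rw [Real.zero_rpow (by linarith)] at h
      simpa using (h.mono_left nhdsWithin_le_nhds).mul_const ((1 : ℝ)⁻¹ * ‖a‖⁻¹)
    refine squeeze_zero_norm' ?_ hlim
    filter_upwards [self_mem_nhdsWithin] with y (hy : 0 < y)
    exact norm_log_one_add_mul_cpow_div_le hy one_pos le_rfl
  -- With `ε = -Re a / 2` the bound has exponent `ε + Re a = Re a / 2 < 0`, so it decays at
  -- infinity.
  · have hε : 0 < -(a.re / 2) := by linarith
    have hlim : Tendsto (fun y : ℝ => y ^ (-(a.re / 2) + a.re) * ((-(a.re / 2))⁻¹ * ‖a‖⁻¹))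
        atTop (𝓝 0) := by
      have h := tendsto_rpow_neg_atTop hε
      rw [show -(a.re / 2) + a.re = -(-(a.re / 2)) by ring]
      simpa using h.mul_const ((-(a.re / 2))⁻¹ * ‖a‖⁻¹)
    refine squeeze_zero_norm' ?_ hlim
    filter_upwards [eventually_gt_atTop 0] with y hy
    exact norm_log_one_add_mul_cpow_div_le hy hε (by linarith)

/-! ### Gamma on vertical lines and integrability of the Barnes kernel -/

theorem norm_Gamma_le_Gamma_re {s : ℂ} (hs : 0 < s.re) : ‖Complex.Gamma s‖ ≤ Real.Gamma s.re := by
  rw [Complex.Gamma_eq_integral hs, Complex.GammaIntegral, Real.Gamma_eq_integral hs]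
  refine (norm_integral_le_integral_norm _).trans (le_of_eq ?_)
  refine setIntegral_congr_fun measurableSet_Ioi fun x (hx : 0 < x) => ?_
  simp only [norm_mul, Complex.norm_real, Real.norm_eq_abs, abs_of_pos (Real.exp_pos _),
    norm_ofReal_cpow_of_pos hx]
  simp

theorem continuousAt_Gamma_of_re_pos {s : ℂ} (hs : 0 < s.re) : ContinuousAt Complex.Gamma s := by
  refine (Complex.differentiableAt_Gamma s fun m h => ?_).continuousAt
  rw [h] at hs
  simp at hs
  linarith [(Nat.cast_nonneg m : (0 : ℝ) ≤ m)]

/-- Each factor satisfies `‖z‖² ≥ δ² + t² ≥ δ² (1 + t²)`, the last step because `δ ≤ 1`. -/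
theorem one_add_sq_le_norm_mul_norm {c d : ℂ} {δ t : ℝ} (h0 : 0 < δ) (h1 : δ ≤ 1)
    (hc : δ ≤ c.re) (hd : δ ≤ d.re) (hct : c.im ^ 2 = t ^ 2) (hdt : d.im ^ 2 = t ^ 2) :
    δ ^ 2 * (1 + t ^ 2) ≤ ‖c‖ * ‖d‖ := by
  have key : ∀ z : ℂ, δ ≤ z.re → z.im ^ 2 = t ^ 2 → δ ^ 2 * (1 + t ^ 2) ≤ ‖z‖ ^ 2 := by
    intro z hz hzt
    rw [← Complex.normSq_eq_norm_sq, Complex.normSq_apply, ← sq, ← sq, hzt]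
    nlinarith [mul_nonneg (sq_nonneg t) (by nlinarith : 0 ≤ 1 - δ ^ 2)]
  refine le_of_sq_le_sq ?_ (by positivity)
  rw [mul_pow ‖c‖, sq (δ ^ 2 * (1 + t ^ 2))]
  exact mul_le_mul (key c hc hct) (key d hd hdt) (by positivity) (by positivity)

/-- Decay of the Gamma function along a vertical line in the right half-plane. -/
theorem norm_Gamma_le_div_one_add_sq {s : ℂ} (h0 : 0 < s.re) (h1 : s.re ≤ 1) :
    ‖Complex.Gamma s‖ ≤ Real.Gamma (s.re + 2) / s.re ^ 2 * (1 + s.im ^ 2)⁻¹ := by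
  have hs : s ≠ 0 := fun h => by simp [h] at h0
  have hs1 : s + 1 ≠ 0 := fun h => by
    have : (s + 1).re = 0 := by rw [h]; simp
    simp at this; linarith
  have hG : Complex.Gamma (s + 2) = (s + 1) * (s * Complex.Gamma s) := by
    rw [← Complex.Gamma_add_one s hs, ← Complex.Gamma_add_one (s + 1) hs1]
    congr 1; ring
  have hle := norm_Gamma_le_Gamma_re (s := s + 2) (by simp; linarith)
  rw [hG, norm_mul, norm_mul] at hle
  simp only [Complex.add_re, Complex.re_ofNat] at hle
  have hb := one_add_sq_le_norm_mul_norm (c := s + 1) (d := s) (t := s.im) h0 h1 (by simp) le_rfl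
    (by simp) rfl
  rw [← div_eq_mul_inv, div_div, le_div_iff₀ (by positivity)]
  calc ‖Complex.Gamma s‖ * (s.re ^ 2 * (1 + s.im ^ 2))
      ≤ ‖Complex.Gamma s‖ * (‖s + 1‖ * ‖s‖) := by gcongr
    _ ≤ _ := by linarith

/-- The Mellin-Barnes kernel, as a function of `w = -s`. -/
def barnesKernel (N : ℕ) (w : ℂ) : ℂ :=
  Complex.Gamma w *
    (Complex.Gamma (1 + (N - w)) * Complex.Gamma (-(N - w)) / (-(N - w)))

theorem integrable_barnesKernel {N : ℕ} {ρ : ℝ} (h0 : (N : ℝ) < ρ) (h1 : ρ < N + 1) :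
    Integrable fun t : ℝ => barnesKernel N (ρ + t * Complex.I) := by
  have hN : (0 : ℝ) ≤ N := Nat.cast_nonneg N
  have hbound : ∀ t : ℝ, ‖barnesKernel N (ρ + t * Complex.I)‖ ≤
      Real.Gamma ρ * (Real.Gamma (1 + (N - ρ) + 2) / (1 + (N - ρ)) ^ 2 * (1 + t ^ 2)⁻¹ *
        Real.Gamma (ρ - N) / (ρ - N)) := by
    intro t
    rw [barnesKernel, norm_mul, norm_div, norm_mul]
    -- Quadratic decay of the middle Gamma factor `e2`, whose real part lies in `(0, 1)`, is enough;
    -- the other factors are merely bounded on the line.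
    have e1 := norm_Gamma_le_Gamma_re (s := ρ + t * Complex.I) (by simp; linarith)
    have e2 := norm_Gamma_le_div_one_add_sq (s := 1 + (N - (ρ + t * Complex.I)))
      (by simp; linarith) (by simp; linarith)
    have e3 := norm_Gamma_le_Gamma_re (s := -(N - (ρ + t * Complex.I))) (by simp; linarith)
    have e4 := Complex.re_le_norm (-(N - (ρ + t * Complex.I)))
    simp at e1 e2 e3 e4
    have p1 := Real.Gamma_pos_of_pos (show 0 < ρ by linarith)
    have p2 := Real.Gamma_pos_of_pos (show 0 < 1 + (N - ρ) + 2 by linarith)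
    have p3 := Real.Gamma_pos_of_pos (show 0 < ρ - N by linarith)
    have p4 : 0 < ρ - N := by linarith
    have p5 : 0 < 1 + (N - ρ) := by linarith
    rw [neg_sub] at *
    gcongr
    linarith
  have hcont : Continuous fun t : ℝ => barnesKernel N (ρ + t * Complex.I) := by
    rw [continuous_iff_continuousAt]
    intro t
    have l : ContinuousAt (fun t : ℝ => (ρ + t * Complex.I : ℂ)) t := by fun_prop
    have g1 : ContinuousAt (fun t : ℝ => Complex.Gamma (ρ + t * Complex.I)) t :=
      ContinuousAt.comp (continuousAt_Gamma_of_re_pos (by simp; linarith)) l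
    have g2 : ContinuousAt (fun t : ℝ => Complex.Gamma (1 + (N - (ρ + t * Complex.I)))) t :=
      ContinuousAt.comp (f := fun t : ℝ => (1 + (N - (ρ + t * Complex.I)) : ℂ))
        (continuousAt_Gamma_of_re_pos (by simp; linarith)) (by fun_prop)
    have g3 : ContinuousAt (fun t : ℝ => Complex.Gamma (-(N - (ρ + t * Complex.I)))) t :=
      ContinuousAt.comp (f := fun t : ℝ => (-(N - (ρ + t * Complex.I)) : ℂ))
        (continuousAt_Gamma_of_re_pos (by simp; linarith)) (by fun_prop)
    refine g1.mul ((g2.mul g3).div (by fun_prop) fun h => ?_)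
    have := congrArg Complex.re h
    simp at this
    linarith
  refine Integrable.mono' (((((integrable_inv_one_add_sq.const_mul _).mul_const _).div_const
    _)).const_mul _) hcont.aestronglyMeasurable (ae_of_all _ hbound)

/-! ### The Meijer function as a Laplace integral -/

/-- `∫_0^∞ log (1 + y) y^(N-1) e^{-zy} dy`. -/
def logLaplace (N : ℕ) (z : ℝ) : ℝ :=
  ∫ y in Ioi (0 : ℝ), Real.log (1 + y) * y ^ (N - 1) * Real.exp (-(z * y))

theorem integrableOn_pow_mul_exp_neg_mul (n : ℕ) {z : ℝ} (hz : 0 < z) :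
    IntegrableOn (fun y : ℝ => y ^ n * Real.exp (-(z * y))) (Ioi 0) := by
  have := integrableOn_rpow_mul_exp_neg_mul_rpow (p := 1) (s := n) (b := z)
    (by linarith [(Nat.cast_nonneg n : (0 : ℝ) ≤ n)]) one_pos hz
  simpa using this

theorem log_one_add_le_self {y : ℝ} (hy : 0 < y) : Real.log (1 + y) ≤ y := by
  linarith [Real.log_le_sub_one_of_pos (show 0 < 1 + y by linarith)]

/-- Mellin inversion recovers the value at a point only where the function is continuous. For
parameters above `z / 2` the integrand is dominated by `y^(n+1) e^(-zy/2)`. -/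
theorem continuousAt_laplaceIntegral_log (n : ℕ) {z : ℝ} (hz : 0 < z) :
    ContinuousAt (laplaceIntegral fun y => (y : ℂ) ^ (n : ℂ) • (Real.log (1 + y) : ℂ)) z := by
  refine continuousAt_of_dominated
    (bound := fun y => y ^ (n + 1) * Real.exp (-(z / 2 * y))) ?_ ?_
    (integrableOn_pow_mul_exp_neg_mul (n + 1) (half_pos hz)) ?_
  · refine Eventually.of_forall fun x => ?_
    exact ((aestronglyMeasurable_ofReal_cpow _).smul
      (continuousOn_log_one_add.aestronglyMeasurable measurableSet_Ioi)).mul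
      (Continuous.aestronglyMeasurable (by fun_prop))
  · filter_upwards [eventually_gt_nhds (half_lt_self hz)] with x hx
    filter_upwards [ae_restrict_mem measurableSet_Ioi] with y (hy : 0 < y)
    rw [norm_mul, norm_smul, norm_ofReal_cpow_of_pos hy, Complex.norm_real, Complex.norm_real,
      Real.norm_of_nonneg (Real.log_nonneg (by linarith)), Real.norm_of_nonneg (Real.exp_pos _).le,
      Complex.natCast_re, Real.rpow_natCast, pow_succ]
    gcongr
    exact log_one_add_le_self hy
  · exact ae_of_all _ fun y => by fun_prop

/-- Meijer's function in the sum-rate formula as an elementary Laplace integral. -/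
theorem gTerm_eq_logLaplace {N : ℕ} (hN : 1 ≤ N) {z : ℝ} (hz : 0 < z) :
    gTerm N z = (logLaplace N z : ℂ) := by
  have hsep : ∃ σ : ℝ, MeijerSeparates 3 1 ![-(N : ℂ), 1 - (N : ℂ)] ![0, -(N : ℂ), -(N : ℂ)] σ :=
    ⟨-N - 1 / 2, (meijerSeparates_gTerm_iff N _).mpr ⟨by linarith, by linarith⟩⟩
  obtain ⟨hσ1, hσ2⟩ := (meijerSeparates_gTerm_iff N _).mp hsep.choose_spec
  rw [gTerm, meijerG, dif_pos hsep]
  -- Which separating line was chosen is irrelevant: only `-N - 1 < σ < -N` is used from here on.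
  generalize hsep.choose = σ at hσ1 hσ2
  set g : ℝ → ℂ := fun y => (y : ℂ) ^ ((N - 1 : ℕ) : ℂ) • (Real.log (1 + y) : ℂ)
  have hcast : ((N - 1 : ℕ) : ℂ) = N - 1 := by push_cast [hN]; ring
  have hmel : ∀ w : ℂ, (N : ℝ) < w.re → w.re < N + 1 →
      HasMellin (laplaceIntegral g) w (barnesKernel N w) := by
    intro w hw1 hw2
    have hw0 : 0 < w.re := lt_of_le_of_lt (Nat.cast_nonneg N) hw1
    have hlog := hasMellin_log_one_add (a := N - w) (by simp; linarith) (by simp; linarith)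
    -- The monomial `y^(N-1)` shifts the Mellin argument from `1 - w` to `N - w`, whose real part
    -- lies in `(-1, 0)`.
    have he : 1 - w + ((N - 1 : ℕ) : ℂ) = N - w := by rw [hcast]; ring
    have hc : MellinConvergent g (1 - w) := by
      rw [MellinConvergent.cpow_smul, he]; exact hlog.1
    have hv := hlog.2
    rw [← he, ← mellin_cpow_smul, he] at hv
    have := hasMellin_laplaceIntegral hw0 hc
    rwa [show mellin g (1 - w) = _ from hv] at this
  have hint := integrable_barnesKernel (N := N) (ρ := -σ) (by linarith) (by linarith)
  have hline : ∀ t : ℝ, mellin (laplaceIntegral g) ((-σ : ℝ) + t * Complex.I) =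
      barnesKernel N ((-σ : ℝ) + t * Complex.I) := fun t =>
    (hmel _ (by simp; linarith) (by simp; linarith)).2
  have hinv := mellinInv_mellin_eq (-σ) (laplaceIntegral g) hz
    (hmel _ (by simp; linarith) (by simp; linarith)).1
    (by simpa only [Complex.VerticalIntegrable, hline] using hint)
    (continuousAt_laplaceIntegral_log (N - 1) hz)
  have hval : laplaceIntegral g z = (logLaplace N z : ℂ) := by
    rw [laplaceIntegral, logLaplace, ← integral_complex_ofReal]
    refine integral_congr_ae (ae_of_all _ fun y => ?_)
    simp only [g, smul_eq_mul, Complex.cpow_natCast]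
    push_cast; ring
  rw [← hval, ← hinv, mellinInv]
  simp only [hline]
  -- The lines for `s` and `w` correspond under `s = -w`, so `t` is replaced by `-t`.
  rw [← integral_neg_eq_self, Complex.real_smul]
  push_cast
  congr 2
  funext t
  have hw : ((σ : ℂ) + -(t : ℂ) * Complex.I) = -(-(σ : ℂ) + t * Complex.I) := by ring
  rw [hw]
  set w : ℂ := -(σ : ℂ) + t * Complex.I with hwdef
  have hd : w - N ≠ 0 := fun h => by
    have := congrArg Complex.re h
    simp [hwdef] at this
    linarith
  have hΓ : Complex.Gamma (w - N) ≠ 0 :=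
    Complex.Gamma_ne_zero_of_re_pos (by simp [hwdef]; linarith)
  simp only [meijerIntegrand, Fin.prod_univ_succ, barnesKernel]
  simp
  -- The denominator is `Γ(w - N + 1) = (w - N) Γ(w - N)`; it cancels one of the two equal Gamma
  -- factors and leaves the kernel.
  rw [show (1 - (N : ℂ) + w) = w - N + 1 by ring, Complex.Gamma_add_one _ hd,
    show -(N : ℂ) + w = w - N by ring, show 1 + (N : ℂ) + -w = 1 + (N - w) by ring]
  field_simp

/-! ### Erlang laws of the channel gains -/

theorem integrableOn_pow_mul_cexp_neg_mul (n : ℕ) {b : ℂ} (hb : 0 < b.re) :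
    IntegrableOn (fun x : ℝ => (x : ℂ) ^ n * Complex.exp (-(b * x))) (Ioi 0) := by
  have hm : AEStronglyMeasurable (fun x : ℝ => (x : ℂ) ^ n * Complex.exp (-(b * x)))
      (volume.restrict (Ioi 0)) := Continuous.aestronglyMeasurable (by fun_prop)
  rw [IntegrableOn, ← integrable_norm_iff hm]
  refine (integrableOn_pow_mul_exp_neg_mul n hb).congr ?_
  filter_upwards [ae_restrict_mem measurableSet_Ioi] with x (hx : 0 < x)
  simp [Complex.norm_exp, abs_of_pos hx]

theorem tendsto_pow_mul_cexp_neg_mul (n : ℕ) {b : ℂ} (hb : 0 < b.re) :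
    Tendsto (fun x : ℝ => (x : ℂ) ^ n * Complex.exp (-(b * x))) atTop (𝓝 0) := by
  rw [tendsto_zero_iff_norm_tendsto_zero]
  have h := (Real.tendsto_pow_mul_exp_neg_atTop_nhds_zero n).comp
    (tendsto_id.const_mul_atTop hb)
  have h' := h.const_mul ((b.re ^ n)⁻¹)
  rw [mul_zero] at h'
  refine h'.congr' ?_
  filter_upwards [eventually_gt_atTop 0] with x hx
  have : b.re ^ n ≠ 0 := by positivity
  simp [Complex.norm_exp, abs_of_pos hx, mul_pow]
  field_simp

/-- The Gamma integral of natural order with a complex rate. -/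
theorem integral_pow_mul_cexp_neg_mul (n : ℕ) {b : ℂ} (hb : 0 < b.re) :
    ∫ x in Ioi (0 : ℝ), (x : ℂ) ^ n * Complex.exp (-(b * x)) = n.factorial / b ^ (n + 1) := by
  have hb0 : b ≠ 0 := fun h => by simp [h] at hb
  have hderiv : ∀ x : ℝ, HasDerivAt (fun x : ℝ => Complex.exp (-(b * x)))
      (-(b * Complex.exp (-(b * x)))) x := fun x => by
    have h := ((((hasDerivAt_id (x : ℂ)).const_mul b).neg).cexp).comp_ofReal
    refine h.congr_deriv ?_
    simp [mul_comm]
  induction n with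
  | zero =>
    have h := integral_Ioi_of_hasDerivAt_of_tendsto' (a := (0 : ℝ)) (m := (0 : ℂ))
      (fun x _ => hderiv x) (by
        have h := integrableOn_pow_mul_cexp_neg_mul 0 hb
        simp only [pow_zero, one_mul] at h
        exact (h.const_mul b).neg)
      (by simpa using tendsto_pow_mul_cexp_neg_mul 0 hb)
    rw [integral_neg, integral_const_mul] at h
    simp at h
    simp
    field_simp
    linear_combination h
  | succ n ih =>
    have hd : ∀ x : ℝ, HasDerivAt (fun x : ℝ => (x : ℂ) ^ (n + 1) * Complex.exp (-(b * x)))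
        ((n + 1) * ((x : ℂ) ^ n * Complex.exp (-(b * x))) -
          b * ((x : ℂ) ^ (n + 1) * Complex.exp (-(b * x)))) x := fun x => by
      have h := ((hasDerivAt_pow (n + 1) (x : ℂ)).comp_ofReal).mul (hderiv x)
      refine h.congr_deriv ?_
      push_cast
      simp
      ring
    have i1 := (integrableOn_pow_mul_cexp_neg_mul n hb).const_mul ((n : ℂ) + 1)
    have i2 := (integrableOn_pow_mul_cexp_neg_mul (n + 1) hb).const_mul b
    -- Both boundary values of `x^(n+1) e^(-bx)` vanish, which gives the recursion `b I_(n+1) = (n +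
    -- 1) I_n`.
    have h := integral_Ioi_of_hasDerivAt_of_tendsto' (a := (0 : ℝ)) (m := (0 : ℂ))
      (fun x _ => hd x) (i1.sub i2) (tendsto_pow_mul_cexp_neg_mul (n + 1) hb)
    rw [integral_sub i1 i2, integral_const_mul, integral_const_mul, ih] at h
    simp at h
    rw [Nat.factorial_succ]
    push_cast
    rw [eq_div_iff (pow_ne_zero _ hb0), pow_succ b (n + 1)]
    field_simp at h
    linear_combination -h

/-- The density of the Erlang law of shape `n` and rate `r` on the positive half-line. -/
def erlangDensity (n : ℕ) (r x : ℝ) : ℝ :=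
  r ^ n / Real.Gamma n * x ^ (n - 1) * Real.exp (-(r * x))

theorem erlangDensity_nonneg {n : ℕ} (hn : 1 ≤ n) {r x : ℝ} (hr : 0 < r) (hx : 0 < x) :
    0 ≤ erlangDensity n r x := by
  have : 0 < Real.Gamma n := Real.Gamma_pos_of_pos (by exact_mod_cast hn)
  unfold erlangDensity
  positivity

theorem measurable_gammaPDF (a r : ℝ) : Measurable (gammaPDF a r) :=
  (measurable_gammaPDFReal a r).ennreal_ofReal

theorem toReal_gammaPDF {n : ℕ} (hn : 1 ≤ n) {r : ℝ} (hr : 0 < r) :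
    (fun x => (gammaPDF n r x).toReal) =ᵐ[volume] (Ioi 0).indicator (erlangDensity n r) := by
  have hn' : (0 : ℝ) < n := by exact_mod_cast hn
  -- `gammaPDF` includes the endpoint `0` in its support, the indicator does not; the point is null.
  have h0 : ∀ᵐ x : ℝ, x ≠ 0 := by simp [ae_iff]
  filter_upwards [h0] with x hx0
  rw [gammaPDF, ENNReal.toReal_ofReal (gammaPDFReal_nonneg hn' hr x), gammaPDFReal]
  rcases lt_or_gt_of_ne hx0 with hx | hx
  · rw [if_neg (by linarith), indicator_of_notMem (by simpa using hx.le)]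
  · rw [if_pos hx.le, indicator_of_mem (by simpa using hx), erlangDensity,
      show (n : ℝ) - 1 = ((n - 1 : ℕ) : ℝ) by push_cast [hn]; ring,
      Real.rpow_natCast, Real.rpow_natCast]

theorem integral_gammaMeasure {E : Type*} [NormedAddCommGroup E] [NormedSpace ℝ E] {n : ℕ}
    (hn : 1 ≤ n) {r : ℝ} (hr : 0 < r) (f : ℝ → E) :
    ∫ x, f x ∂(gammaMeasure n r) = ∫ x in Ioi 0, erlangDensity n r x • f x := by
  rw [gammaMeasure, integral_withDensity_eq_integral_toReal_smul
    (measurable_gammaPDF _ _) (ae_of_all _ fun _ => ENNReal.ofReal_lt_top),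
    ← integral_indicator measurableSet_Ioi]
  refine integral_congr_ae ?_
  filter_upwards [toReal_gammaPDF hn hr] with x hx
  rw [hx]
  by_cases h : x ∈ Ioi (0 : ℝ) <;> simp [h]

theorem integrable_gammaMeasure_iff {n : ℕ} (hn : 1 ≤ n) {r : ℝ} (hr : 0 < r) (f : ℝ → ℝ) :
    Integrable f (gammaMeasure n r) ↔
      IntegrableOn (fun x => erlangDensity n r x * f x) (Ioi 0) := by
  rw [gammaMeasure, integrable_withDensity_iff_integrable_smul'
    (measurable_gammaPDF _ _) (ae_of_all _ fun _ => ENNReal.ofReal_lt_top),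
    ← integrable_indicator_iff measurableSet_Ioi]
  refine integrable_congr ?_
  filter_upwards [toReal_gammaPDF hn hr] with x hx
  rw [hx]
  by_cases h : x ∈ Ioi (0 : ℝ) <;> simp [h]

theorem charFun_gammaMeasure {n : ℕ} (hn : 1 ≤ n) {r : ℝ} (hr : 0 < r) (t : ℝ) :
    charFun (gammaMeasure n r) t = ((r : ℂ) / (r - t * Complex.I)) ^ n := by
  obtain ⟨m, rfl⟩ : ∃ m, n = m + 1 := ⟨n - 1, by omega⟩
  have hb : 0 < ((r : ℂ) - t * Complex.I).re := by simpa using hr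
  have hb0 : (r : ℂ) - t * Complex.I ≠ 0 := fun h => by simp [h] at hb
  have hf : (m.factorial : ℂ) ≠ 0 := by exact_mod_cast m.factorial_ne_zero
  have hΓ : Real.Gamma ((m + 1 : ℕ) : ℝ) = m.factorial := by
    push_cast; exact Real.Gamma_nat_eq_factorial m
  rw [charFun_apply_real, integral_gammaMeasure hn hr]
  have h : ∀ x : ℝ, erlangDensity (m + 1) r x • Complex.exp (t * x * Complex.I) =
      ((r : ℂ) ^ (m + 1) / m.factorial) *
        ((x : ℂ) ^ m * Complex.exp (-((r - t * Complex.I) * x))) := fun x => by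
    rw [erlangDensity, hΓ, Complex.real_smul,
      show -((r - t * Complex.I) * x) = -((r : ℂ) * x) + t * x * Complex.I by ring,
      Complex.exp_add]
    push_cast
    ring
  simp only [h]
  rw [integral_const_mul, integral_pow_mul_cexp_neg_mul m hb, div_pow]
  field_simp

/-- The characteristic function of the squared modulus of a circular complex normal. -/
theorem charFun_map_normSq_complexNormal {v : ℝ} (hv : 0 < v) (t : ℝ) :
    charFun ((complexNormal v).map fun z => ‖z‖ ^ 2) t =
      ((v⁻¹ : ℝ) : ℂ) / ((v⁻¹ : ℝ) - t * Complex.I) := by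
  have hm : Measurable fun z : ℂ => ‖z‖ ^ 2 := by fun_prop
  have hv2 : (v / 2).toNNReal ≠ 0 := by simpa using hv
  have hvc : (v : ℂ) ≠ 0 := by exact_mod_cast hv.ne'
  have hb : 0 < (((v⁻¹ : ℝ) : ℂ) - t * Complex.I).re := by simpa using hv
  have hb0 : ((v⁻¹ : ℝ) : ℂ) - t * Complex.I ≠ 0 := fun h => by
    rw [h] at hb; simp at hb
  rw [charFun_apply_real, integral_map hm.aemeasurable
    (Continuous.aestronglyMeasurable (by fun_prop)), complexNormal,
    integral_map_equiv]
  have h1 : ∀ p : ℝ × ℝ, Complex.exp (t * ((‖Complex.measurableEquivRealProd.symm p‖ ^ 2 : ℝ) : ℂ)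
      * Complex.I) = Complex.exp (t * (p.1 : ℂ) ^ 2 * Complex.I) *
        Complex.exp (t * (p.2 : ℂ) ^ 2 * Complex.I) := fun p => by
    rw [← Complex.exp_add, ← Complex.normSq_eq_norm_sq, Complex.normSq_apply]
    congr 1
    simp [Complex.measurableEquivRealProd_symm_apply]
    ring
  simp only [h1]
  rw [integral_prod_mul (fun x : ℝ => Complex.exp (t * (x : ℂ) ^ 2 * Complex.I))
    (fun x : ℝ => Complex.exp (t * (x : ℂ) ^ 2 * Complex.I)),
    integral_gaussianReal_eq_integral_smul hv2]
  have h2 : ∀ x : ℝ, gaussianPDFReal 0 (v / 2).toNNReal x •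
      Complex.exp (t * (x : ℂ) ^ 2 * Complex.I) =
      (((√(Real.pi * v))⁻¹ : ℝ) : ℂ) *
        Complex.exp (-(((v⁻¹ : ℝ) : ℂ) - t * Complex.I) * (x : ℂ) ^ 2) := fun x => by
    rw [gaussianPDFReal, Complex.real_smul, Real.coe_toNNReal _ (by positivity),
      show 2 * Real.pi * (v / 2) = Real.pi * v by ring, Complex.ofReal_mul, mul_assoc,
      Complex.ofReal_exp, ← Complex.exp_add]
    congr 2
    push_cast
    field_simp
    ring
  simp only [h2]
  rw [integral_const_mul, integral_gaussian_complex hb]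
  set b : ℂ := ((v⁻¹ : ℝ) : ℂ) - t * Complex.I
  -- Real and imaginary part contribute the same principal square root, so their product involves no
  -- choice of branch.
  have h3 : ((Real.pi / b) ^ (1 / 2 : ℂ)) * ((Real.pi / b) ^ (1 / 2 : ℂ)) = Real.pi / b := by
    rw [← Complex.cpow_add _ _ (div_ne_zero (by exact_mod_cast Real.pi_ne_zero) hb0)]
    norm_num
  have h4 : (((√(Real.pi * v))⁻¹ : ℝ) : ℂ) * (((√(Real.pi * v))⁻¹ : ℝ) : ℂ) =
      (Real.pi * v : ℂ)⁻¹ := by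
    rw [← Complex.ofReal_mul, ← mul_inv, Real.mul_self_sqrt (by positivity)]
    push_cast; rfl
  have hpi : (Real.pi : ℂ) ≠ 0 := by exact_mod_cast Real.pi_ne_zero
  calc _ = ((((√(Real.pi * v))⁻¹ : ℝ) : ℂ) * (((√(Real.pi * v))⁻¹ : ℝ) : ℂ)) *
        (((Real.pi / b) ^ (1 / 2 : ℂ)) * ((Real.pi / b) ^ (1 / 2 : ℂ))) := by ring
    _ = _ := by
      rw [h3, h4]
      push_cast
      field_simp

/-- The maximal-ratio-combining gain has an Erlang law. -/
theorem hasLaw_mrcGain {S : Type*} [MeasurableSpace S] {μ : Measure S} [IsProbabilityMeasure μ]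
    {N : ℕ} (hN : 1 ≤ N) {v : ℝ} (hv : 0 < v) {h : Fin N → S → ℂ}
    (law : ∀ i, HasLaw (h i) (complexNormal v) μ) (hind : iIndepFun h μ) :
    HasLaw (fun ω => mrcGain fun i => h i ω) (gammaMeasure N v⁻¹) μ := by
  have hm : Measurable fun z : ℂ => ‖z‖ ^ 2 := by fun_prop
  have hae : ∀ i, AEMeasurable (fun ω => ‖h i ω‖ ^ 2) μ := fun i =>
    hm.comp_aemeasurable (law i).aemeasurable
  have haes : AEMeasurable (fun ω => mrcGain fun i => h i ω) μ :=
    Finset.aemeasurable_fun_sum _ fun i _ => hae i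
  refine ⟨haes, ?_⟩
  have := Measure.isProbabilityMeasure_map haes
  have := isProbabilityMeasure_gammaMeasure (a := N) (r := v⁻¹) (by exact_mod_cast hN)
    (inv_pos.mpr hv)
  refine Measure.ext_of_charFun (funext fun t => ?_)
  have hind' : iIndepFun (fun i ω => ‖h i ω‖ ^ 2) μ := hind.comp (fun _ z => ‖z‖ ^ 2) fun _ => hm
  have hsum := hind'.charFun_map_fun_sum_eq_prod hae
  rw [charFun_gammaMeasure hN (inv_pos.mpr hv)]
  change charFun (μ.map fun ω => ∑ i, ‖h i ω‖ ^ 2) t = _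
  rw [hsum, Finset.prod_apply]
  have hi : ∀ i, charFun (μ.map fun ω => ‖h i ω‖ ^ 2) t =
      ((v⁻¹ : ℝ) : ℂ) / ((v⁻¹ : ℝ) - t * Complex.I) := fun i => by
    rw [← charFun_map_normSq_complexNormal hv, ← (law i).map_eq,
      AEMeasurable.map_map_of_aemeasurable hm.aemeasurable (law i).aemeasurable]
    rfl
  simp only [hi, Finset.prod_const, Finset.card_univ, Fintype.card_fin]

/-! ### Erlang tails -/

/-- The tail of the Erlang law of shape `n` and rate `r`. -/
def erlangTail (n : ℕ) (r x : ℝ) : ℝ :=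
  Real.exp (-(r * x)) * ∑ k ∈ Finset.range n, (r * x) ^ k / k.factorial

theorem hasDerivAt_erlangTail {n : ℕ} (hn : 1 ≤ n) (r x : ℝ) :
    HasDerivAt (erlangTail n r) (-erlangDensity n r x) x := by
  obtain ⟨m, rfl⟩ : ∃ m, n = m + 1 := ⟨n - 1, by omega⟩
  have hexp : HasDerivAt (fun x => Real.exp (-(r * x))) (-(r * Real.exp (-(r * x)))) x := by
    have h := (((hasDerivAt_id x).const_mul r).neg).exp
    exact h.congr_deriv (by simp [mul_comm])
  have hsum : ∀ m : ℕ, HasDerivAt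
      (fun x => ∑ k ∈ Finset.range (m + 1), (r * x) ^ k / (k.factorial : ℝ))
      (r * ∑ k ∈ Finset.range m, (r * x) ^ k / k.factorial) x := by
    intro m
    induction m with
    | zero => simpa using hasDerivAt_const x (1 : ℝ)
    | succ m ih =>
      simp only [Finset.sum_range_succ _ (m + 1)]
      have h := (((hasDerivAt_id x).const_mul r).pow (m + 1)).div_const ((m + 1).factorial : ℝ)
      refine (ih.add h).congr_deriv ?_
      have hf : (m.factorial : ℝ) ≠ 0 := by exact_mod_cast m.factorial_ne_zero
      rw [Finset.sum_range_succ, Nat.factorial_succ]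
      push_cast
      simp
      field_simp
  have h := hexp.mul (hsum m)
  -- In the product rule the two sums telescope; only the top term `k = m` survives, and it is the
  -- density.
  refine h.congr_deriv ?_
  rw [erlangDensity, Finset.sum_range_succ,
    show Real.Gamma ((m + 1 : ℕ) : ℝ) = m.factorial by
      push_cast; exact Real.Gamma_nat_eq_factorial m, Nat.add_sub_cancel]
  ring

theorem tendsto_erlangTail (n : ℕ) {r : ℝ} (hr : 0 < r) :
    Tendsto (erlangTail n r) atTop (𝓝 0) := by
  have h : Tendsto (fun x => ∑ k ∈ Finset.range n,
      ((r * x) ^ k * Real.exp (-(r * x))) / (k.factorial : ℝ)) atTop (𝓝 0) := by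
    rw [← Finset.sum_const_zero (ι := ℕ) (s := Finset.range n)]
    refine tendsto_finsetSum _ fun k _ => ?_
    have h := (Real.tendsto_pow_mul_exp_neg_atTop_nhds_zero k).comp
      (tendsto_id.const_mul_atTop hr)
    simpa using h.div_const (k.factorial : ℝ)
  refine h.congr fun x => ?_
  rw [erlangTail, Finset.mul_sum]
  exact Finset.sum_congr rfl fun k _ => by ring

theorem measureReal_gammaMeasure_Ioi {n : ℕ} (hn : 1 ≤ n) {r : ℝ} (hr : 0 < r) {x : ℝ}
    (hx : 0 ≤ x) : (gammaMeasure n r).real (Ioi x) = erlangTail n r x := by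
  have h1 : ∀ y : ℝ, erlangDensity n r y • (Ioi x).indicator (1 : ℝ → ℝ) y =
      (Ioi x).indicator (erlangDensity n r) y := fun y => by
    by_cases h : y ∈ Ioi x <;> simp [h]
  have h2 := integral_Ioi_of_hasDerivAt_of_nonpos' (a := x)
    (fun y _ => hasDerivAt_erlangTail hn r y)
    (fun y (hy : x < y) => neg_nonpos.mpr (erlangDensity_nonneg hn hr (by linarith)))
    (tendsto_erlangTail n hr)
  rw [integral_neg] at h2
  rw [← integral_indicator_one measurableSet_Ioi, integral_gammaMeasure hn hr]
  simp only [h1]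
  rw [setIntegral_indicator measurableSet_Ioi, inter_eq_self_of_subset_right (Ioi_subset_Ioi hx)]
  linarith

theorem measureReal_gammaMeasure_Ici {n : ℕ} (hn : 1 ≤ n) {r : ℝ} (hr : 0 < r) {x : ℝ}
    (hx : 0 ≤ x) : (gammaMeasure n r).real (Ici x) = erlangTail n r x := by
  rw [← measureReal_gammaMeasure_Ioi hn hr hx]
  refine measureReal_congr ?_
  have : gammaMeasure n r ≪ volume := withDensity_absolutelyContinuous _ _
  exact this.ae_le Ioi_ae_eq_Ici.symm

/-! ### Minimum of two independent variables -/

section Min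
variable {γ₁ γ₂ : Measure ℝ} [IsProbabilityMeasure γ₁] [IsProbabilityMeasure γ₂]

/-- Ties are assigned to the first variable, whence a closed tail `Ici` in one integral and an open
tail `Ioi` in the other. -/
theorem comp_min_eq_indicator_add (h : ℝ → ℝ) :
    (fun p : ℝ × ℝ => h (min p.1 p.2)) = fun p =>
      {p : ℝ × ℝ | p.1 ≤ p.2}.indicator (fun p => h p.1) p +
        {p : ℝ × ℝ | p.2 < p.1}.indicator (fun p => h p.2) p := by
  funext p
  rcases le_or_gt p.1 p.2 with hp | hp
  · simp [hp, not_lt.mpr hp]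
  · simp [hp, not_le.mpr hp, min_eq_right hp.le]

theorem integrable_comp_min {h : ℝ → ℝ} (h1 : Integrable h γ₁) (h2 : Integrable h γ₂) :
    Integrable (fun p : ℝ × ℝ => h (min p.1 p.2)) (γ₁.prod γ₂) := by
  rw [comp_min_eq_indicator_add]
  exact ((h1.comp_fst γ₂).indicator (measurableSet_le measurable_fst measurable_snd)).add
    ((h2.comp_snd γ₁).indicator (measurableSet_lt measurable_snd measurable_fst))

/-- The expectation of a function of the minimum of two independent variables. -/
theorem integral_comp_min {h : ℝ → ℝ} (h1 : Integrable h γ₁) (h2 : Integrable h γ₂) :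
    ∫ p : ℝ × ℝ, h (min p.1 p.2) ∂(γ₁.prod γ₂) =
      ∫ x, γ₂.real (Ici x) * h x ∂γ₁ + ∫ y, γ₁.real (Ioi y) * h y ∂γ₂ := by
  have i1 := (h1.comp_fst γ₂).indicator (measurableSet_le measurable_fst measurable_snd)
  have i2 := (h2.comp_snd γ₁).indicator (measurableSet_lt measurable_snd measurable_fst)
  rw [comp_min_eq_indicator_add, integral_add i1 i2, integral_prod _ i1, integral_prod_symm _ i2]
  congr 1
  · refine integral_congr_ae (ae_of_all _ fun x => ?_)
    have : (fun y => {p : ℝ × ℝ | p.1 ≤ p.2}.indicator (fun p => h p.1) (x, y)) =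
        (Ici x).indicator fun _ => h x := by
      funext y; simp [indicator]
    simp only [this]
    rw [integral_indicator_const _ measurableSet_Ici, smul_eq_mul]
  · refine integral_congr_ae (ae_of_all _ fun y => ?_)
    have : (fun x => {p : ℝ × ℝ | p.2 < p.1}.indicator (fun p => h p.2) (x, y)) =
        (Ioi y).indicator fun _ => h y := by
      funext x; simp [indicator]
    simp only [this]
    rw [integral_indicator_const _ measurableSet_Ioi, smul_eq_mul]

end Min

/-! ### Expected logarithms of Erlang gains -/

theorem integrableOn_log_mul_pow_mul_exp (m : ℕ) {c r : ℝ} (hc : 0 < c) (hr : 0 < r) :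
    IntegrableOn (fun x => Real.log (1 + c * x) * x ^ m * Real.exp (-(r * x))) (Ioi 0) := by
  refine Integrable.mono' ((integrableOn_pow_mul_exp_neg_mul (m + 1) hr).const_mul c) ?_ ?_
  · exact Measurable.aestronglyMeasurable (by fun_prop)
  · filter_upwards [ae_restrict_mem measurableSet_Ioi] with x (hx : 0 < x)
    have hcx : 0 < c * x := mul_pos hc hx
    have hl : 0 ≤ Real.log (1 + c * x) := Real.log_nonneg (by linarith)
    rw [Real.norm_of_nonneg (by positivity), pow_succ]
    calc _ ≤ (c * x) * x ^ m * Real.exp (-(r * x)) := by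
          gcongr; exact log_one_add_le_self hcx
      _ = _ := by ring

theorem integral_log_mul_pow_mul_exp {n : ℕ} (hn : 1 ≤ n) {c : ℝ} (hc : 0 < c) (r : ℝ) :
    ∫ x in Ioi 0, Real.log (1 + c * x) * x ^ (n - 1) * Real.exp (-(r * x)) =
      1 / c ^ n * logLaplace n (r / c) := by
  have h := integral_comp_mul_left_Ioi
    (fun y => Real.log (1 + y) * y ^ (n - 1) * Real.exp (-(r / c * y))) 0 hc
  rw [mul_zero, smul_eq_mul] at h
  obtain ⟨m, rfl⟩ : ∃ m, n = m + 1 := ⟨n - 1, by omega⟩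
  have he : ∀ x : ℝ, Real.log (1 + c * x) * x ^ (m + 1 - 1) * Real.exp (-(r * x)) =
      (c ^ m)⁻¹ * (Real.log (1 + c * x) * (c * x) ^ (m + 1 - 1) *
        Real.exp (-(r / c * (c * x)))) := fun x => by
    rw [Nat.add_sub_cancel, show r / c * (c * x) = r * x by field_simp, mul_pow]
    field_simp
  simp only [he]
  rw [integral_const_mul, h, logLaplace, ← mul_assoc, pow_succ, one_div, mul_inv]

theorem integrable_log_gammaMeasure {n : ℕ} (hn : 1 ≤ n) {c r : ℝ} (hc : 0 < c) (hr : 0 < r) :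
    Integrable (fun x => Real.log (1 + c * x)) (gammaMeasure n r) := by
  rw [integrable_gammaMeasure_iff hn hr]
  refine ((integrableOn_log_mul_pow_mul_exp (n - 1) hc hr).const_mul
    (r ^ n / Real.Gamma n)).congr (ae_of_all _ fun x => ?_)
  simp only [erlangDensity]
  ring

theorem integral_log_gammaMeasure {n : ℕ} (hn : 1 ≤ n) {c r : ℝ} (hc : 0 < c) (hr : 0 < r) :
    ∫ x, Real.log (1 + c * x) ∂(gammaMeasure n r) =
      r ^ n / Real.Gamma n * (1 / c ^ n * logLaplace n (r / c)) := by
  rw [integral_gammaMeasure hn hr, ← integral_log_mul_pow_mul_exp hn hc, ← integral_const_mul]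
  refine integral_congr_ae (ae_of_all _ fun x => ?_)
  simp only [erlangDensity, smul_eq_mul]
  ring

/-- The `k`-th term of the tail raises the shape from `n` to `n + k` and the rate from `r` to `r +
s`, so each term is again a `logLaplace`. -/
theorem integral_erlangTail_mul_log {n : ℕ} (hn : 1 ≤ n) (m : ℕ) {c r s : ℝ} (hc : 0 < c)
    (hr : 0 < r) (hs : 0 < s) :
    ∫ x in Ioi 0, erlangDensity n r x • (erlangTail m s x * Real.log (1 + c * x)) =
      r ^ n / Real.Gamma n * ∑ k ∈ Finset.range m,
        s ^ k / k.factorial * (1 / c ^ (n + k) * logLaplace (n + k) ((r + s) / c)) := by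
  have he : ∀ x : ℝ, erlangDensity n r x • (erlangTail m s x * Real.log (1 + c * x)) =
      r ^ n / Real.Gamma n * ∑ k ∈ Finset.range m, s ^ k / k.factorial *
        (Real.log (1 + c * x) * x ^ (n + k - 1) * Real.exp (-((r + s) * x))) := fun x => by
    rw [erlangDensity, erlangTail, smul_eq_mul, show -((r + s) * x) = -(r * x) + -(s * x) by ring,
      Real.exp_add, Finset.mul_sum, Finset.sum_mul, Finset.mul_sum, Finset.mul_sum]
    refine Finset.sum_congr rfl fun k _ => ?_
    rw [show n + k - 1 = (n - 1) + k by omega, pow_add, mul_pow]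
    ring
  simp only [he]
  rw [integral_const_mul, integral_finsetSum]
  · congr 1
    refine Finset.sum_congr rfl fun k _ => ?_
    rw [integral_const_mul, integral_log_mul_pow_mul_exp (by omega) hc]
  · intro k _
    exact (integrableOn_log_mul_pow_mul_exp _ hc (by linarith)).const_mul _

theorem integral_log_min_gammaMeasure {n m : ℕ} (hn : 1 ≤ n) (hm : 1 ≤ m) {c r s : ℝ}
    (hc : 0 < c) (hr : 0 < r) (hs : 0 < s) :
    ∫ p : ℝ × ℝ, Real.log (1 + c * min p.1 p.2) ∂((gammaMeasure n r).prod (gammaMeasure m s)) =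
      r ^ n / Real.Gamma n * ∑ k ∈ Finset.range m,
        s ^ k / k.factorial * (1 / c ^ (n + k) * logLaplace (n + k) ((r + s) / c)) +
      s ^ m / Real.Gamma m * ∑ l ∈ Finset.range n,
        r ^ l / l.factorial * (1 / c ^ (m + l) * logLaplace (m + l) ((r + s) / c)) := by
  have := isProbabilityMeasure_gammaMeasure (a := n) (r := r) (by exact_mod_cast hn) hr
  have := isProbabilityMeasure_gammaMeasure (a := m) (r := s) (by exact_mod_cast hm) hs
  rw [integral_comp_min (integrable_log_gammaMeasure hn hc hr)
    (integrable_log_gammaMeasure hm hc hs), integral_gammaMeasure hn hr, integral_gammaMeasure hm hs,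
    ← integral_erlangTail_mul_log hn m hc hr hs, add_comm r s,
    ← integral_erlangTail_mul_log hm n hc hs hr]
  congr 1
  · refine setIntegral_congr_fun measurableSet_Ioi fun x (hx : 0 < x) => ?_
    rw [measureReal_gammaMeasure_Ici hm hs hx.le]
  · refine setIntegral_congr_fun measurableSet_Ioi fun x (hx : 0 < x) => ?_
    rw [measureReal_gammaMeasure_Ioi hn hr hx.le]

/-! ### Algebra of the instantaneous rate -/

theorem mrcGain_nonneg {N : ℕ} (h : Fin N → ℂ) : 0 ≤ mrcGain h :=
  Finset.sum_nonneg fun _ _ => sq_nonneg _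

theorem one_add_sinrFar {an af P g : ℝ} (han : 0 ≤ an) (hsum : an + af = 1) (hP : 0 ≤ P)
    (hg : 0 ≤ g) : 1 + sinrFar an af P g = (1 + P * g) / (1 + an * P * g) := by
  have : 0 < 1 + an * P * g := by positivity
  have h' : an * g * P + 1 ≠ 0 := by nlinarith
  rw [sinrFar, eq_div_iff this.ne']
  field_simp
  rw [show af = 1 - an by linarith]
  ring

theorem logb_one_add_sinrFar {an af P g : ℝ} (han : 0 ≤ an) (hsum : an + af = 1) (hP : 0 ≤ P)
    (hg : 0 ≤ g) : Real.logb 2 (1 + sinrFar an af P g) =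
      Real.logb 2 (1 + P * g) - Real.logb 2 (1 + an * P * g) := by
  rw [one_add_sinrFar han hsum hP hg, Real.logb_div (by positivity) (by positivity)]

/-- After cross-multiplying, the claim is `P (g' - g) (1 - an) ≥ 0`. -/
theorem logb_one_add_sinrFar_mono {an af P g g' : ℝ} (han : 0 ≤ an) (hle : an ≤ 1)
    (hsum : an + af = 1) (hP : 0 ≤ P) (hg : 0 ≤ g) (hgg : g ≤ g') :
    Real.logb 2 (1 + sinrFar an af P g) ≤ Real.logb 2 (1 + sinrFar an af P g') := by
  have hg' := hg.trans hgg
  rw [one_add_sinrFar han hsum hP hg, one_add_sinrFar han hsum hP hg']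
  refine Real.logb_le_logb_of_le one_lt_two (by positivity) ?_
  rw [div_le_div_iff₀ (by positivity) (by positivity)]
  nlinarith [mul_nonneg (mul_nonneg hP (sub_nonneg.mpr hgg)) (sub_nonneg.mpr hle)]

theorem min_logb_one_add_sinrFar {an af P x y : ℝ} (han : 0 ≤ an) (hle : an ≤ 1)
    (hsum : an + af = 1) (hP : 0 ≤ P) (hx : 0 ≤ x) (hy : 0 ≤ y) :
    min (Real.logb 2 (1 + sinrFar an af P x)) (Real.logb 2 (1 + sinrFar an af P y)) =
      Real.logb 2 (1 + P * min x y) - Real.logb 2 (1 + an * P * min x y) := by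
  rw [← logb_one_add_sinrFar han hsum hP (le_min hx hy)]
  rcases le_total x y with h | h
  · rw [min_eq_left h, min_eq_left (logb_one_add_sinrFar_mono han hle hsum hP hx h)]
  · rw [min_eq_right h, min_eq_right (logb_one_add_sinrFar_mono han hle hsum hP hy h)]

theorem oneBitPower_nonneg {I Ppeak : ℝ} (hP : 0 ≤ Ppeak) (gp : ℝ) :
    0 ≤ oneBitPower I Ppeak gp := by
  unfold oneBitPower
  split_ifs <;> simp [hP]

theorem oneBitSumRate_eq_oneBitSumRateMin {an af I Ppeak : ℝ} (han : 0 < an) (hle : an ≤ 1)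
    (hsum : an + af = 1) (hP : 0 < Ppeak) {Nn Nf : ℕ} (hp : ℂ) (hn : Fin Nn → ℂ)
    (hf : Fin Nf → ℂ) :
    oneBitSumRate an af I Ppeak hp hn hf = oneBitSumRateMin an I Ppeak hp hn hf := by
  rw [oneBitSumRate, sumRate, min_logb_one_add_sinrFar han.le hle hsum
    (oneBitPower_nonneg hP.le _) (mrcGain_nonneg hn) (mrcGain_nonneg hf), oneBitSumRateMin, snrNear,
    mul_right_comm]
  ring

/-- The sum-rate at constant transmit power, in natural units, as a function of both gains. -/
def natSumRate (an P : ℝ) (p : ℝ × ℝ) : ℝ :=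
  Real.log (1 + an * P * p.1) + Real.log (1 + P * min p.1 p.2) -
    Real.log (1 + an * P * min p.1 p.2)

theorem measurable_natSumRate (an P : ℝ) : Measurable (natSumRate an P) := by
  unfold natSumRate
  fun_prop

theorem oneBitSumRateMin_eq_indicator_mul (an I Ppeak : ℝ) {Nn Nf : ℕ} (hp : ℂ) (hn : Fin Nn → ℂ)
    (hf : Fin Nf → ℂ) :
    oneBitSumRateMin an I Ppeak hp hn hf =
      (Iic (I / Ppeak)).indicator 1 (‖hp‖ ^ 2) *
        (natSumRate an Ppeak (mrcGain hn, mrcGain hf) / Real.log 2) := by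
  by_cases h : ‖hp‖ ^ 2 ≤ I / Ppeak
  · simp only [oneBitSumRateMin, oneBitPower, if_pos h, natSumRate, Real.logb]
    rw [indicator_of_mem (by exact h), Pi.one_apply]
    ring
  · simp only [oneBitSumRateMin, oneBitPower, if_neg h]
    rw [indicator_of_notMem (by exact h)]
    simp

theorem integral_natSumRate {n m : ℕ} (hn : 1 ≤ n) (hm : 1 ≤ m) {an P r s : ℝ}
    (han : 0 < an) (hP : 0 < P) (hr : 0 < r) (hs : 0 < s) :
    Integrable (natSumRate an P) ((gammaMeasure n r).prod (gammaMeasure m s)) ∧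
    ∫ p, natSumRate an P p ∂((gammaMeasure n r).prod (gammaMeasure m s)) =
      r ^ n / Real.Gamma n * (1 / (an * P) ^ n * logLaplace n (r / (an * P))) +
      r ^ n / Real.Gamma n * ∑ k ∈ Finset.range m, s ^ k / k.factorial * (1 / P ^ (n + k)) *
        (logLaplace (n + k) ((r + s) / P) -
          1 / an ^ (n + k) * logLaplace (n + k) ((r + s) / (an * P))) +
      s ^ m / Real.Gamma m * ∑ l ∈ Finset.range n, r ^ l / l.factorial * (1 / P ^ (m + l)) *
        (logLaplace (m + l) ((r + s) / P) -
          1 / an ^ (m + l) * logLaplace (m + l) ((r + s) / (an * P))) := by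
  have := isProbabilityMeasure_gammaMeasure (a := n) (r := r) (by exact_mod_cast hn) hr
  have := isProbabilityMeasure_gammaMeasure (a := m) (r := s) (by exact_mod_cast hm) hs
  have haP : 0 < an * P := mul_pos han hP
  have i1 := (integrable_log_gammaMeasure hn haP hr).comp_fst (gammaMeasure m s)
  have i2 := integrable_comp_min (integrable_log_gammaMeasure hn hP hr)
    (integrable_log_gammaMeasure hm hP hs)
  have i3 := integrable_comp_min (integrable_log_gammaMeasure hn haP hr)
    (integrable_log_gammaMeasure hm haP hs)
  refine ⟨(i1.add i2).sub i3, ?_⟩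
  have hsplit : ∀ (q N : ℕ) (t : ℝ), ∑ k ∈ Finset.range q,
      t ^ k / k.factorial * (1 / P ^ (N + k)) * (logLaplace (N + k) ((r + s) / P) -
          1 / an ^ (N + k) * logLaplace (N + k) ((r + s) / (an * P))) =
      ∑ k ∈ Finset.range q, t ^ k / k.factorial *
        (1 / P ^ (N + k) * logLaplace (N + k) ((r + s) / P)) -
      ∑ k ∈ Finset.range q, t ^ k / k.factorial *
        (1 / (an * P) ^ (N + k) * logLaplace (N + k) ((r + s) / (an * P))) := by
    intro q N t
    rw [← Finset.sum_sub_distrib]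
    refine Finset.sum_congr rfl fun k _ => ?_
    rw [mul_pow, one_div_mul_eq_div]
    field_simp
  unfold natSumRate
  rw [integral_sub (by exact i1.add i2) i3, integral_add i1 i2, integral_log_min_gammaMeasure hn hm hP hr hs,
    integral_log_min_gammaMeasure hn hm haP hr hs, integral_fun_fst
      (fun x => Real.log (1 + an * P * x)), integral_log_gammaMeasure hn haP hr, hsplit, hsplit]
  simp only [probReal_univ, one_smul]
  ring

/-! ### Independence and averaging over the channel -/

section Channel
variable {S : Type*} [MeasurableSpace S] {μ : Measure S} {Nn Nf : ℕ}
  {hp : S → ℂ} {hn : Fin Nn → S → ℂ} {hf : Fin Nf → S → ℂ}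

/-- The two gains depend on disjoint blocks `A` and `B` of one independent family. -/
theorem indepFun_mrcGain (hmeas : ∀ i, AEMeasurable (Sum.elim hn hf i) μ)
    (hind : iIndepFun (Sum.elim hn hf) μ) :
    IndepFun (fun ω => mrcGain fun i => hn i ω) (fun ω => mrcGain fun j => hf j ω) μ := by
  classical
  let A : Finset (Fin Nn ⊕ Fin Nf) := Finset.univ.map ⟨Sum.inl, Sum.inl_injective⟩
  let B : Finset (Fin Nn ⊕ Fin Nf) := Finset.univ.map ⟨Sum.inr, Sum.inr_injective⟩
  have hA : ∀ i, Sum.inl i ∈ A := by simp [A]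
  have hB : ∀ j, Sum.inr j ∈ B := by simp [B]
  have hAB : Disjoint A B := by
    rw [Finset.disjoint_left]; simp [A, B]
  have h := hind.indepFun_finset₀ A B hAB hmeas
  have hφ : Measurable fun v : A → ℂ => ∑ i, ‖v ⟨Sum.inl i, hA i⟩‖ ^ 2 := by fun_prop
  have hψ : Measurable fun v : B → ℂ => ∑ j, ‖v ⟨Sum.inr j, hB j⟩‖ ^ 2 := by fun_prop
  exact h.comp hφ hψ

theorem indepFun_normSq_mrcGain
    (hmeas : ∀ i, AEMeasurable (Sum.elim (fun _ : Unit => hp) (Sum.elim hn hf) i) μ)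
    (hind : iIndepFun (Sum.elim (fun _ : Unit => hp) (Sum.elim hn hf)) μ) :
    IndepFun (fun ω => ‖hp ω‖ ^ 2)
      (fun ω => (mrcGain fun i => hn i ω, mrcGain fun j => hf j ω)) μ := by
  classical
  let A : Finset (Unit ⊕ (Fin Nn ⊕ Fin Nf)) := Finset.univ.map ⟨Sum.inl, Sum.inl_injective⟩
  let B : Finset (Unit ⊕ (Fin Nn ⊕ Fin Nf)) := Finset.univ.map ⟨Sum.inr, Sum.inr_injective⟩
  have hA : Sum.inl () ∈ A := by simp [A]
  have hB : ∀ j, Sum.inr j ∈ B := by simp [B]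
  have hAB : Disjoint A B := by
    rw [Finset.disjoint_left]; simp [A, B]
  have h := hind.indepFun_finset₀ A B hAB hmeas
  exact h.comp (φ := fun v => ‖v ⟨Sum.inl (), hA⟩‖ ^ 2)
    (ψ := fun v => (∑ i, ‖v ⟨Sum.inr (Sum.inl i), hB _⟩‖ ^ 2,
      ∑ j, ‖v ⟨Sum.inr (Sum.inr j), hB _⟩‖ ^ 2)) (by fun_prop) (by fun_prop)

theorem measureReal_gammaMeasure_one_Iic {r x : ℝ} (hr : 0 < r) (hx : 0 ≤ x) :
    (gammaMeasure ((1 : ℕ) : ℝ) r).real (Iic x) = 1 - Real.exp (-(r * x)) := by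
  have := isProbabilityMeasure_gammaMeasure (a := ((1 : ℕ) : ℝ)) (r := r) (by simp) hr
  have h := probReal_compl_eq_one_sub (μ := gammaMeasure ((1 : ℕ) : ℝ) r)
    (measurableSet_Ioi (a := x))
  rw [compl_Ioi, measureReal_gammaMeasure_Ioi le_rfl hr hx, erlangTail] at h
  simpa using h

/-- The average sum-rate factors into the transmission probability and the sum-rate at peak power. -/
theorem integral_oneBitSumRateMin [IsProbabilityMeasure μ] (hNn : 1 ≤ Nn) (hNf : 1 ≤ Nf) {Ωp Ωn Ωf : ℝ} (hΩp : 0 < Ωp)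
    (hΩn : 0 < Ωn) (hΩf : 0 < Ωf) {an I Ppeak : ℝ} (han : 0 < an) (hI : 0 < I)
    (hPpeak : 0 < Ppeak)
    (lawp : HasLaw hp (complexNormal Ωp) μ)
    (lawn : ∀ i, HasLaw (hn i) (complexNormal Ωn) μ)
    (lawf : ∀ j, HasLaw (hf j) (complexNormal Ωf) μ)
    (hindep : iIndepFun (Sum.elim (fun _ : Unit => hp) (Sum.elim hn hf)) μ) :
    Integrable (fun ω => oneBitSumRateMin an I Ppeak
      (hp ω) (fun i => hn i ω) (fun j => hf j ω)) μ ∧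
    ∫ ω, oneBitSumRateMin an I Ppeak (hp ω) (fun i => hn i ω) (fun j => hf j ω) ∂μ =
      (1 - Real.exp (-(I / Ppeak) / Ωp)) / Real.log 2 *
        ∫ p, natSumRate an Ppeak p
          ∂((gammaMeasure Nn Ωn⁻¹).prod (gammaMeasure Nf Ωf⁻¹)) := by
  have hmeas : ∀ i, AEMeasurable (Sum.elim (fun _ : Unit => hp) (Sum.elim hn hf) i) μ := by
    rintro (_ | i | j)
    exacts [lawp.aemeasurable, (lawn i).aemeasurable, (lawf j).aemeasurable]
  have hind2 : iIndepFun (Sum.elim hn hf) μ := hindep.precomp (g := Sum.inr) Sum.inr_injective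
  -- A single coefficient is the one-antenna case: `|hp|²` is Erlang of shape `1`, that is,
  -- exponential.
  have hpl : HasLaw (fun ω => ‖hp ω‖ ^ 2) (gammaMeasure ((1 : ℕ) : ℝ) Ωp⁻¹) μ := by
    have h := hasLaw_mrcGain (N := 1) le_rfl hΩp (h := fun _ => hp) (fun _ => lawp)
      (hindep.precomp (g := fun _ : Fin 1 => Sum.inl ()) (Function.injective_of_subsingleton _))
    simpa [mrcGain] using h
  have hnl := hasLaw_mrcGain hNn hΩn lawn (hind2.precomp (g := Sum.inl) Sum.inl_injective)
  have hfl := hasLaw_mrcGain hNf hΩf lawf (hind2.precomp (g := Sum.inr) Sum.inr_injective)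
  have := isProbabilityMeasure_gammaMeasure (a := Nn) (r := Ωn⁻¹) (by exact_mod_cast hNn)
    (inv_pos.mpr hΩn)
  have := isProbabilityMeasure_gammaMeasure (a := Nf) (r := Ωf⁻¹) (by exact_mod_cast hNf)
    (inv_pos.mpr hΩf)
  have hnf : HasLaw (fun ω => (mrcGain fun i => hn i ω, mrcGain fun j => hf j ω))
      ((gammaMeasure Nn Ωn⁻¹).prod (gammaMeasure Nf Ωf⁻¹)) μ :=
    (indepFun_iff_hasLaw_prodMk_prod hnl hfl).mp
      (indepFun_mrcGain (fun i => hmeas (Sum.inr i)) hind2)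
  obtain ⟨hint, -⟩ := integral_natSumRate hNn hNf han hPpeak (inv_pos.mpr hΩn) (inv_pos.mpr hΩf)
  have hind3 := indepFun_normSq_mrcGain hmeas hindep
  set X : S → ℝ := fun ω => (Iic (I / Ppeak)).indicator 1 (‖hp ω‖ ^ 2) with hX
  set Y : S → ℝ := fun ω =>
    natSumRate an Ppeak (mrcGain fun i => hn i ω, mrcGain fun j => hf j ω) / Real.log 2 with hY
  have hmX : Measurable ((Iic (I / Ppeak)).indicator (1 : ℝ → ℝ)) :=
    measurable_one.indicator measurableSet_Iic
  have hmY : Measurable fun p => natSumRate an Ppeak p / Real.log 2 :=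
    (measurable_natSumRate an Ppeak).div_const _
  have hXY : IndepFun X Y μ := hind3.comp hmX hmY
  have hYint : Integrable Y μ := by
    have h := hint.div_const (Real.log 2)
    rw [← hnf.map_eq] at h
    exact h.comp_aemeasurable hnf.aemeasurable
  have hXm : AEMeasurable X μ := hmX.comp_aemeasurable hpl.aemeasurable
  have hXint : Integrable X μ := by
    refine Integrable.of_bound hXm.aestronglyMeasurable 1 (ae_of_all _ fun ω => ?_)
    exact (norm_indicator_le_norm_self _ _).trans (by simp)
  have hEX : ∫ ω, X ω ∂μ = 1 - Real.exp (-(I / Ppeak) / Ωp) := by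
    have h := hpl.integral_comp (f := (Iic (I / Ppeak)).indicator (1 : ℝ → ℝ))
      hmX.aestronglyMeasurable
    rw [integral_indicator_one measurableSet_Iic,
      measureReal_gammaMeasure_one_Iic (inv_pos.mpr hΩp) (by positivity)] at h
    rw [show -(I / Ppeak) / Ωp = -(Ωp⁻¹ * (I / Ppeak)) by ring, ← h]
    rfl
  have hEY : ∫ ω, Y ω ∂μ = (∫ p, natSumRate an Ppeak p
      ∂((gammaMeasure Nn Ωn⁻¹).prod (gammaMeasure Nf Ωf⁻¹))) / Real.log 2 := by
    have h := hnf.integral_comp (f := fun p => natSumRate an Ppeak p / Real.log 2)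
      hmY.aestronglyMeasurable
    rw [integral_div] at h
    exact h
  simp only [oneBitSumRateMin_eq_indicator_mul]
  refine ⟨hXY.integrable_mul hXint hYint, ?_⟩
  rw [show (∫ ω, X ω * Y ω ∂μ) = _ from
    hXY.integral_fun_mul_eq_mul_integral hXint.aestronglyMeasurable hYint.aestronglyMeasurable,
    hEX, hEY]
  ring

end Channel

end NOMA

end

/-! ### Assembly of the closed form -/

theorem mainTheorem10 {S : Type*} [MeasurableSpace S] (μ : Measure S) [IsProbabilityMeasure μ]
    (Nn Nf : ℕ) (hNn : 1 ≤ Nn) (hNf : 1 ≤ Nf)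
    (Ωp Ωn Ωf : ℝ) (hΩp : 0 < Ωp) (hΩn : 0 < Ωn) (hΩf : 0 < Ωf)
    (an af : ℝ) (han : 0 < an) (hlt : an < af) (hsum : an + af = 1)
    (I Ppeak : ℝ) (hI : 0 < I) (hPpeak : 0 < Ppeak)
    (hp : S → ℂ) (hn : Fin Nn → S → ℂ) (hf : Fin Nf → S → ℂ)
    (lawp : HasLaw hp (NOMA.complexNormal Ωp) μ)
    (lawn : ∀ i, HasLaw (hn i) (NOMA.complexNormal Ωn) μ)
    (lawf : ∀ j, HasLaw (hf j) (NOMA.complexNormal Ωf) μ)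
    (hindep : iIndepFun (Sum.elim (fun _ : Unit => hp) (Sum.elim hn hf)) μ)
    (τ Ω : ℝ) (hτ : τ = I / Ppeak) (hΩ : Ω = Ωn * Ωf / (Ωn + Ωf)) :
    Integrable (fun ω => NOMA.oneBitSumRate an af I Ppeak
      (hp ω) (fun i => hn i ω) (fun j => hf j ω)) μ ∧
    Integrable (fun ω => NOMA.oneBitSumRateMin an I Ppeak
      (hp ω) (fun i => hn i ω) (fun j => hf j ω)) μ ∧
    ∫ ω, NOMA.oneBitSumRate an af I Ppeak (hp ω) (fun i => hn i ω) (fun j => hf j ω) ∂μ =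
      ∫ ω, NOMA.oneBitSumRateMin an I Ppeak (hp ω) (fun i => hn i ω) (fun j => hf j ω) ∂μ ∧
    ((∫ ω, NOMA.oneBitSumRate an af I Ppeak (hp ω) (fun i => hn i ω) (fun j => hf j ω) ∂μ : ℝ) :
        ℂ) =
      (((1 - Real.exp (-τ / Ωp)) / Real.log 2 : ℝ) : ℂ) *
        ((1 / (Complex.Gamma Nn * (Ωn : ℂ) ^ Nn * ((an : ℂ) * Ppeak) ^ Nn)) *
            NOMA.gTerm Nn (1 / (Ωn * an * Ppeak))
          + (1 / (Complex.Gamma Nn * (Ωn : ℂ) ^ Nn)) *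
            ∑ k ∈ Finset.range Nf,
              (1 / ((k.factorial : ℂ) * (Ωf : ℂ) ^ k * (Ppeak : ℂ) ^ (Nn + k))) *
                (NOMA.gTerm (Nn + k) (1 / (Ω * Ppeak))
                  - (1 / (an : ℂ) ^ (Nn + k)) * NOMA.gTerm (Nn + k) (1 / (Ω * an * Ppeak)))
          + (1 / (Complex.Gamma Nf * (Ωf : ℂ) ^ Nf)) *
            ∑ l ∈ Finset.range Nn,
              (1 / ((l.factorial : ℂ) * (Ωn : ℂ) ^ l * (Ppeak : ℂ) ^ (Nf + l))) *
                (NOMA.gTerm (Nf + l) (1 / (Ω * Ppeak))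
                  - (1 / (an : ℂ) ^ (Nf + l)) * NOMA.gTerm (Nf + l) (1 / (Ω * an * Ppeak)))) := by
  obtain ⟨hint, hval⟩ := NOMA.integral_oneBitSumRateMin hNn hNf hΩp hΩn hΩf han hI hPpeak
    lawp lawn lawf hindep
  simp only [NOMA.oneBitSumRate_eq_oneBitSumRateMin han (by linarith) hsum hPpeak]
  -- Both rates are now the same function, so the equality of expectations has been simplified to
  -- `True`.
  refine ⟨hint, hint, trivial, ?_⟩
  have hΩpos : 0 < Ω := by rw [hΩ]; positivity
  have hΩinv : Ωn⁻¹ + Ωf⁻¹ = Ω⁻¹ := by rw [hΩ]; field_simp; ring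
  have e1 : Ωn⁻¹ / (an * Ppeak) = 1 / (Ωn * an * Ppeak) := by field_simp
  have e2 : Ω⁻¹ / Ppeak = 1 / (Ω * Ppeak) := by field_simp
  have e3 : Ω⁻¹ / (an * Ppeak) = 1 / (Ω * an * Ppeak) := by field_simp
  have z1 : 0 < 1 / (Ωn * an * Ppeak) := by positivity
  have z2 : 0 < 1 / (Ω * Ppeak) := by positivity
  have z3 : 0 < 1 / (Ω * an * Ppeak) := by positivity
  rw [hval, (NOMA.integral_natSumRate hNn hNf han hPpeak (inv_pos.mpr hΩn) (inv_pos.mpr hΩf)).2,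
    hΩinv, e1, e2, e3, hτ, Complex.ofReal_mul, NOMA.gTerm_eq_logLaplace hNn z1]
  -- One conversion serves both finite sums, which differ only by exchanging the users.
  have hsumc : ∀ (q N : ℕ) (v : ℝ), 1 ≤ N →
      ∑ k ∈ Finset.range q, (1 / ((k.factorial : ℂ) * (v : ℂ) ^ k * (Ppeak : ℂ) ^ (N + k))) *
        (NOMA.gTerm (N + k) (1 / (Ω * Ppeak))
          - (1 / (an : ℂ) ^ (N + k)) * NOMA.gTerm (N + k) (1 / (Ω * an * Ppeak))) =
      ((∑ k ∈ Finset.range q, v⁻¹ ^ k / k.factorial * (1 / Ppeak ^ (N + k)) *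
        (NOMA.logLaplace (N + k) (1 / (Ω * Ppeak)) -
          1 / an ^ (N + k) * NOMA.logLaplace (N + k) (1 / (Ω * an * Ppeak))) : ℝ) : ℂ) := by
    intro q N v hN
    push_cast
    refine Finset.sum_congr rfl fun k _ => ?_
    rw [NOMA.gTerm_eq_logLaplace (by omega) z2, NOMA.gTerm_eq_logLaplace (by omega) z3,
      inv_pow, one_div, mul_inv, mul_inv]
    ring
  rw [hsumc Nf Nn Ωf hNn, hsumc Nn Nf Ωn hNf]
  have hG : ∀ N : ℕ, Complex.Gamma N = (Real.Gamma N : ℂ) := fun N => by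
    rw [← Complex.Gamma_ofReal]; simp
  rw [hG, hG]
  congr 1
  rw [Complex.ofReal_add, Complex.ofReal_add, Complex.ofReal_mul _ (Finset.sum _ _),
    Complex.ofReal_mul _ (Finset.sum _ _)]
  congr 1
  · congr 1
    · push_cast
      rw [inv_pow, one_div, one_div, mul_inv, mul_inv]
      ring
    · congr 1
      push_cast
      rw [inv_pow, one_div, mul_inv]
      ring
  · congr 1
    push_cast
    rw [inv_pow, one_div, mul_inv]
    ring
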